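/- Let $q$ be a prime power, let $0<k<n\le m$ be integers, let $C\subseteq\mathbb F_{q^m}^n$ be an $\mathbb F_{q^m}$-linear subspace of dimension $k$, and let $\theta$ be a generator of $\mathrm{Gal}(\mathbb F_{q^m}/\mathbb F_q)$. Notation. The $q$-rank $\mathrm{rk}_q(v)$ of a vector $v$ over $\mathbb F_{q^m}$ is the $\mathbb F_q$-dimension of the $\mathbb F_q$-span of its entries. For a non-zero code $D\subseteq\mathbb F_{q^m}^n$, $d(D)=\min\{\mathrm{rk}_q(u-v): u,v\in D,\ u\ne v\}$ is its minimum rank distance, and $D$ is MRD if $d(D)=n-\dim D+1$. The dual $C^\perp$ is taken with respect to the standard inner product. For $1\le r\le n$, a $\theta$-Gabidulin code of dimension $r$ is a code $\mathcal G_{r,\theta}(g)=\{(f(g_1),\dots,f(g_n)) : f=f_0\,\mathrm{id}+f_1\theta+\dots+f_{r-1}\theta^{r-1},\ f_i\in\mathbb F_{q^m}\}$ with $g\in\mathbb F_{q^m}^n$, $\mathrm{rk}_q(g)=n$. Applying $\theta$ entrywise, put $s_i^\theta(C)=\dim\sum_{j=0}^i\theta^j(C)$, $t_i^\theta(C)=\dim\bigcap_{j=0}^i\theta^j(C)$,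 $\Delta_i^\theta(C)=s_{i+1}^\theta(C)-s_i^\theta(C)$ and $\Lambda_i^\theta(C)=t_i^\theta(C)-t_{i+1}^\theta(C)$ (dimensions over $\mathbb F_{q^m}$). For a matrix $M$, $\mathrm{rs}(M)$ is its row space over $\mathbb F_{q^m}$. Then the following are equivalent: 1. $C$ is a $\theta$-Gabidulin code of dimension $k$. 2. $C^\perp$ is a $\theta$-Gabidulin code of dimension $n-k$. 3. $C$ is MRD and $s_1^\theta(C)=k+1$. 4. $C$ is MRD and $t_1^\theta(C)=k-1$. 5. $(s_i^\theta(C))_{i=0}^{n-k}=(k,k+1,\dots,n)$ and $d(C)>1$. 6. $(t_i^\theta(C))_{i=0}^{k}=(k,k-1,\dots,0)$ and $d(C^\perp)>1$. 7. $s_1^\theta(C)=k+1$, $s_{n-k}^\theta(C)=n$ and $d(C)>1$. 8. $t_1^\theta(C)=k-1$, $t_k^\theta(C)=0$ and $d(C^\perp)>1$. 9. $(\Delta_i^\theta(C))_{i=0}^{n-k}=(1,\dots,1,0)$ and $d(C)>1$. 10. $(\Lambda_i^\theta(C))_{i=0}^{k}=(1,\dots,1,0)$ and $d(C^\perp)>1$.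 11. $\Delta_0^\theta(C)=\Delta_{n-k-1}^\theta(C)=1$ and $d(C)>1$. 12. $\Lambda_0^\theta(C)=\Lambda_{k-1}^\theta(C)=1$ and $d(C^\perp)>1$. 13. $C=\mathrm{rs}(I_k\mid X)$ for some $X\in\mathbb F_{q^m}^{k\times(n-k)}$ such that (a) $\mathrm{rk}(\theta(X)-X)=1$, (b) the $q$-rank of the first row of $\theta(X)-X$ is $n-k$, (c) the $q$-rank of the first column of $\theta(X)-X$ is $k$, where $\theta$ is applied to $X$ entrywise. -/

import Mathlib

namespace RankMetric

section Rank

variable (F : Type*) {K : Type*} [Field F] [Field K] [Algebra F K]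

/-- The `q`-rank of a vector `g` over the extension field `K` of `F = F_q`: the `F`-dimension of
the `F`-span of its entries. -/
noncomputable def qRank {ι : Type*} (g : ι → K) : ℕ :=
  Module.finrank F (Submodule.span F (Set.range g))

/-- The rank distance. -/
noncomputable def rankDist {n : ℕ} (u v : Fin n → K) : ℕ := qRank F (u - v)

/-- The minimum distance of a (non-zero) linear code: the smallest distance of two distinct
codewords. -/
noncomputable def minDist {n : ℕ} (C : Submodule K (Fin n → K)) : ℕ :=
  sInf {d : ℕ | ∃ u ∈ C, ∃ v ∈ C, u ≠ v ∧ d = rankDist F u v}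

/-- A non-zero code is maximum rank distance if `d = n - k + 1`, where `k` is its dimension. -/
def IsMRD {n : ℕ} (C : Submodule K (Fin n → K)) : Prop :=
  C ≠ ⊥ ∧ minDist F C + Module.finrank K C = n + 1

end Rank

/-- The dual code with respect to the standard inner product. -/
def dualCode {K : Type*} [Field K] {n : ℕ} (C : Submodule K (Fin n → K)) :
    Submodule K (Fin n → K) where
  carrier := {u | ∀ v ∈ C, u ⬝ᵥ v = 0}
  zero_mem' := fun v _ => zero_dotProduct v
  add_mem' := by
    intro a b ha hb v hv
    rw [add_dotProduct, ha v hv, hb v hv, add_zero]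
  smul_mem' := by
    intro c a ha v hv
    rw [smul_dotProduct, ha v hv, smul_zero]

section Sequences

variable {F K : Type*} [Field F] [Field K] [Algebra F K] {n : ℕ}

/-- The code `σ(C)`, where `σ` is applied entrywise to all codewords of `C`. -/
def galImage (σ : K ≃ₐ[F] K) (C : Submodule K (Fin n → K)) : Submodule K (Fin n → K) where
  carrier := (fun (v : Fin n → K) (j : Fin n) => σ (v j)) '' (C : Set (Fin n → K))
  zero_mem' := ⟨0, C.zero_mem, by ext j; simp⟩
  add_mem' := by
    rintro _ _ ⟨v, hv, rfl⟩ ⟨w, hw, rfl⟩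
    exact ⟨v + w, C.add_mem hv hw, by ext j; simp⟩
  smul_mem' := by
    rintro c _ ⟨v, hv, rfl⟩
    exact ⟨σ.symm c • v, C.smul_mem _ hv, by ext j; simp⟩

/-- `S_i^σ(C) = C + σ(C) + ⋯ + σ^i(C)`. -/
def sumCode (σ : K ≃ₐ[F] K) (i : ℕ) (C : Submodule K (Fin n → K)) : Submodule K (Fin n → K) :=
  ⨆ j ∈ Finset.range (i + 1), galImage (σ ^ j) C

/-- `T_i^σ(C) = C ∩ σ(C) ∩ ⋯ ∩ σ^i(C)`. -/
def interCode (σ : K ≃ₐ[F] K) (i : ℕ) (C : Submodule K (Fin n → K)) : Submodule K (Fin n → K) :=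
  ⨅ j ∈ Finset.range (i + 1), galImage (σ ^ j) C

/-- The `i`-th `σ`-sum-dimension `s_i^σ(C)`. -/
noncomputable def sumDim (σ : K ≃ₐ[F] K) (i : ℕ) (C : Submodule K (Fin n → K)) : ℕ :=
  Module.finrank K (sumCode σ i C)

/-- The `i`-th `σ`-intersection-dimension `t_i^σ(C)`. -/
noncomputable def interDim (σ : K ≃ₐ[F] K) (i : ℕ) (C : Submodule K (Fin n → K)) : ℕ :=
  Module.finrank K (interCode σ i C)

/-- The `i`-th `σ`-sum-increment `Δ_i^σ(C) = s_{i+1}^σ(C) - s_i^σ(C)`. -/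
noncomputable def sumIncr (σ : K ≃ₐ[F] K) (i : ℕ) (C : Submodule K (Fin n → K)) : ℤ :=
  (sumDim σ (i + 1) C : ℤ) - (sumDim σ i C : ℤ)

/-- The `i`-th `σ`-intersection-decrement `Λ_i^σ(C) = t_i^σ(C) - t_{i+1}^σ(C)`. -/
noncomputable def interDecr (σ : K ≃ₐ[F] K) (i : ℕ) (C : Submodule K (Fin n → K)) : ℤ :=
  (interDim σ i C : ℤ) - (interDim σ (i + 1) C : ℤ)

end Sequences

section Gabidulin

variable {F K : Type*} [Field F] [Field K] [Algebra F K]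

/-- The subspace `G_{k,θ} = {f_0 id + f_1 θ + ⋯ + f_{k-1} θ^{k-1}}` of the skew group algebra
`K[Gal(K/F)]`. -/
noncomputable def gabSpace (k : ℕ) (θ : K ≃ₐ[F] K) :
    Submodule K (SkewMonoidAlgebra K (K ≃ₐ[F] K)) :=
  Submodule.span K (Set.range fun i : Fin k => SkewMonoidAlgebra.single (θ ^ (i : ℕ)) (1 : K))

/-- Componentwise evaluation `f ↦ (f(g_1), …, f(g_n))` of elements of the skew group algebra,
where `f(x) = ∑ f_σ σ(x)` for `f = ∑ f_σ σ`. -/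
noncomputable def evalVec {n : ℕ} (g : Fin n → K) :
    SkewMonoidAlgebra K (K ≃ₐ[F] K) →ₗ[K] (Fin n → K) where
  toFun f := fun j => f.sum fun σ a => a * σ (g j)
  map_add' f₁ f₂ := by
    ext j
    exact SkewMonoidAlgebra.sum_add_index' (fun σ => zero_mul _) (fun σ a b => add_mul _ _ _)
  map_smul' c f := by
    ext j
    refine (SkewMonoidAlgebra.sum_smul_index' (fun σ => zero_mul (σ (g j)))).trans ?_
    simp [SkewMonoidAlgebra.sum_def', Finset.mul_sum, mul_assoc]

/-- The code `G_{k,θ}(g) = {(f(g_1), …, f(g_n)) | f ∈ G_{k,θ}}`. -/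
noncomputable def gabCode {n : ℕ} (k : ℕ) (θ : K ≃ₐ[F] K) (g : Fin n → K) :
    Submodule K (Fin n → K) :=
  (gabSpace k θ).map (evalVec g)

/-- `C` is a `θ`-Gabidulin code of dimension `k`: it is `G_{k,θ}(g)` for some `g` of `q`-rank `n`,
with `1 ≤ k ≤ n`. -/
def IsGabidulin {n : ℕ} (k : ℕ) (θ : K ≃ₐ[F] K) (C : Submodule K (Fin n → K)) : Prop :=
  1 ≤ k ∧ k ≤ n ∧ ∃ g : Fin n → K, qRank F g = n ∧ C = gabCode k θ g

end Gabidulin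

/-- The block matrix `(I_k ∣ X)` with its columns indexed by `Fin n`. -/
def systematicMatrix {K : Type*} [Field K] {k n : ℕ} (h : k ≤ n)
    (X : Matrix (Fin k) (Fin (n - k)) K) : Matrix (Fin k) (Fin n) K :=
  Matrix.reindex (Equiv.refl (Fin k)) (finSumFinEquiv.trans (finCongr (Nat.add_sub_of_le h)))
    (Matrix.fromCols (1 : Matrix (Fin k) (Fin k) K) X)

/-- The row space of a matrix. -/
def rowSpace {K : Type*} [Field K] {k n : ℕ} (M : Matrix (Fin k) (Fin n) K) :
    Submodule K (Fin n → K) :=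
  Submodule.span K (Set.range M.row)

end RankMetric

/-!
Over the ground field `F`, call a vector with entries in `F` rational. The whole equivalence goes
through one condition on the code `C` (`GabCriterion`): `dim (C + θ(C)) = dim C + 1`, and neither
`C` nor `C^⊥` contains a non-zero rational vector. Since duality exchanges sums and intersections of
the codes `θ^j(C)` and `dim (C + θ(C)) + dim (C ∩ θ(C)) = 2 dim C`, this condition is self-dual, and
each statement about intersections or about `C^⊥` is the corresponding statement about sums for the
dual code.

Two facts drive the proof. Galois descent (`exists_ratVec_mem`): a non-zero `θ`-stable space contains
a non-zero rational vector, because the fixed field of `θ` is `F`. Concavity (`sumDim_concave`): the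
increments of `s_i` do not increase, and once the chain `S_i` stalls it is `θ`-stable. Hence if
`C^⊥` has no rational vectors then `s_i` grows until it reaches `n`, and the start `s_1 = k + 1`
fixes the whole sequence; conversely `s_i = n` for some `i` excludes rational vectors from `C^⊥`.
A code has minimum distance greater than one exactly when it has no rational vectors.

For a line spanned by `g` with entries independent over `F`, the same growth argument gives the
independence of `g, θ(g), …, θ^{n-1}(g)` (`linearIndependent_moore`), whence Gabidulin codes are MRD.
In the other direction, the criterion makes `C ∩ ⋯ ∩ θ^{k-1}(C)` a line, whose generator is
`θ^{k-1}(g)` for a vector `g` with `C = ⟨g, …, θ^{k-1}(g)⟩` (`GabCriterion.isGabidulin`). That an MRD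
code satisfies the rationality conditions is a refinement of the Singleton bound.

Finally, for `C` generated by `(I ∣ X)` the dimension of `C ∩ θ(C)` is `k - rk (θ(X) - X)`, and when
`θ(X) - X = u wᵀ` the rational vectors of `C` and of `C^⊥` correspond to the relations over `F`
between the entries of `u` and of `w` (`gabCriterion_rowSpace_iff`). MRD codes have such a generator
matrix.
-/

open Module

namespace RankMetric

/-! ### Rational vectors and Galois images of codes -/

section Galois

variable {F K : Type*} [Field F] [Field K] [Algebra F K] {n : ℕ}

/-- A vector with entries in `F`, viewed as a vector over the extension field `K`. -/
def ratVec (K : Type*) [Field K] [Algebra F K] {ι : Type*} (a : ι → F) : ι → K :=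
  fun j => algebraMap F K (a j)

/-- `C` contains no non-zero vector with entries in the ground field `F`. -/
def NoRat (F : Type*) [Field F] [Algebra F K] (C : Submodule K (Fin n → K)) : Prop :=
  ∀ a : Fin n → F, ratVec K a ∈ C → a = 0

lemma ratVec_eq_zero {ι : Type*} {a : ι → F} : ratVec K a = 0 ↔ a = 0 := by
  refine ⟨fun h => ?_, fun h => ?_⟩
  · ext j
    simpa [ratVec] using congrFun h j
  · ext j
    simp [ratVec, h]

lemma ratVec_dotProduct {ι : Type*} [Fintype ι] (a : ι → F) (v : ι → K) :
    ratVec K a ⬝ᵥ v = ∑ j, a j • v j := by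
  simp [ratVec, dotProduct, Algebra.smul_def]

lemma linearIndependent_iff_ratVec {ι : Type*} [Fintype ι] {v : ι → K} :
    LinearIndependent F v ↔ ∀ a : ι → F, ratVec K a ⬝ᵥ v = 0 → a = 0 := by
  simp only [Fintype.linearIndependent_iff, ratVec_dotProduct, funext_iff, Pi.zero_apply]

lemma qRank_eq_iff {v : Fin n → K} : qRank F v = n ↔ LinearIndependent F v := by
  rw [linearIndependent_iff_card_eq_finrank_span, Fintype.card_fin, eq_comm]
  rfl

lemma mem_galImage {σ : K ≃ₐ[F] K} {C : Submodule K (Fin n → K)} {v : Fin n → K} :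
    v ∈ galImage σ C ↔ (fun j => σ.symm (v j)) ∈ C := by
  constructor
  · rintro ⟨w, hw, rfl⟩
    simpa using hw
  · intro h
    exact ⟨_, h, by ext j; simp⟩

lemma map_mem_galImage {σ : K ≃ₐ[F] K} {C : Submodule K (Fin n → K)} {v : Fin n → K}
    (hv : v ∈ C) : (fun j => σ (v j)) ∈ galImage σ C := ⟨v, hv, rfl⟩

lemma ratVec_mem_galImage {σ : K ≃ₐ[F] K} {C : Submodule K (Fin n → K)} {a : Fin n → F} :
    ratVec K a ∈ galImage σ C ↔ ratVec K a ∈ C := by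
  rw [mem_galImage]
  simp only [ratVec, AlgEquiv.commutes]
  rfl

lemma galImage_mul (σ τ : K ≃ₐ[F] K) (C : Submodule K (Fin n → K)) :
    galImage (σ * τ) C = galImage σ (galImage τ C) := by
  ext v
  simp only [mem_galImage]
  rfl

lemma galImage_one (C : Submodule K (Fin n → K)) : galImage (1 : K ≃ₐ[F] K) C = C := by
  ext v
  simp only [mem_galImage]
  rfl

/-- Applying an automorphism entrywise, as an automorphism of the lattice of codes. -/
def galIso (σ : K ≃ₐ[F] K) : Submodule K (Fin n → K) ≃o Submodule K (Fin n → K) where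
  toFun := galImage σ
  invFun := galImage σ⁻¹
  left_inv C := by rw [← galImage_mul, inv_mul_cancel, galImage_one]
  right_inv C := by rw [← galImage_mul, mul_inv_cancel, galImage_one]
  map_rel_iff' := by
    intro C D
    constructor
    · intro h v hv
      have := mem_galImage.1 (h (map_mem_galImage (σ := σ) hv))
      simpa using this
    · intro h v hv
      exact mem_galImage.2 (h (mem_galImage.1 hv))

lemma galImage_eq_galIso (σ : K ≃ₐ[F] K) (C : Submodule K (Fin n → K)) :
    galImage σ C = galIso σ C := rfl

lemma galImage_mono (σ : K ≃ₐ[F] K) {C D : Submodule K (Fin n → K)} (h : C ≤ D) :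
    galImage σ C ≤ galImage σ D := (galIso σ).monotone h

lemma galImage_pow_succ (σ : K ≃ₐ[F] K) (j : ℕ) (C : Submodule K (Fin n → K)) :
    galImage (σ ^ (j + 1)) C = galImage σ (galImage (σ ^ j) C) := by
  rw [pow_succ', galImage_mul]

lemma finrank_galImage (σ : K ≃ₐ[F] K) (C : Submodule K (Fin n → K)) :
    finrank K (galImage σ C) = finrank K C := by
  let e : C ≃+ galImage σ C :=
    { toFun := fun v => ⟨fun j => σ (v.1 j), map_mem_galImage v.2⟩
      invFun := fun v => ⟨fun j => σ.symm (v.1 j), mem_galImage.1 v.2⟩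
      left_inv := fun v => by ext j; simp
      right_inv := fun v => by ext j; simp
      map_add' := fun v w => by ext j; simp }
  refine congrArg Cardinal.toNat (rank_eq_of_equiv_equiv σ e σ.bijective ?_).symm
  intro r v
  ext j
  simp [e]

/-- Galois descent: take a non-zero `u` of minimal support in a `θ`-stable space `U`, with one entry
scaled to `1`; then `θ(u) - u` has smaller support, so it vanishes and `u` is rational. -/
lemma exists_ratVec_mem {θ : K ≃ₐ[F] K} (hfix : ∀ x : K, θ x = x → ∃ a : F, algebraMap F K a = x)
    {U : Submodule K (Fin n → K)} (hU : U ≠ ⊥) (hθU : galImage θ U ≤ U) :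
    ∃ a : Fin n → F, a ≠ 0 ∧ ratVec K a ∈ U := by
  classical
  obtain ⟨v, hv, hv0⟩ := U.exists_mem_ne_zero_of_ne_bot hU
  let supp : (Fin n → K) → ℕ := fun u => (Finset.univ.filter fun j => u j ≠ 0).card
  obtain ⟨u, ⟨huU, hu0⟩, hmin⟩ := exists_minimalFor_of_wellFoundedLT
    (fun u : Fin n → K => u ∈ U ∧ u ≠ 0) supp ⟨v, hv, hv0⟩
  obtain ⟨i, hi⟩ := Function.ne_iff.1 hu0
  rw [Pi.zero_apply] at hi
  let w : Fin n → K := (u i)⁻¹ • u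
  have hwU : w ∈ U := U.smul_mem _ huU
  have hwi : w i = 1 := by simp [w, hi]
  have hd : (fun j => θ (w j)) - w ∈ U := U.sub_mem (hθU (map_mem_galImage hwU)) hwU
  have hw : (fun j => θ (w j)) - w = 0 := by
    by_contra hne
    have hlt : supp ((fun j => θ (w j)) - w) < supp u := by
      refine Finset.card_lt_card (Finset.ssubset_iff_of_subset ?_ |>.2 ⟨i, ?_, ?_⟩)
      · intro j hj
        simp only [Finset.mem_filter, Finset.mem_univ, true_and] at hj ⊢
        intro h0
        apply hj
        simp [w, h0]
      · simpa using hi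
      · simp [hwi]
    exact absurd (hmin ⟨hd, hne⟩ hlt.le) (not_le.2 hlt)
  choose a ha using fun j => hfix (w j) (sub_eq_zero.1 (congrFun hw j))
  have haw : ratVec K a = w := funext ha
  refine ⟨a, ?_, haw ▸ hwU⟩
  rintro rfl
  have := ha i
  simp [hwi] at this

end Galois

/-! ### Dual codes -/

section Dual

variable {F K : Type*} [Field F] [Field K] [Algebra F K] {n : ℕ}

lemma mem_dualCode {C : Submodule K (Fin n → K)} {u : Fin n → K} :
    u ∈ dualCode C ↔ ∀ v ∈ C, u ⬝ᵥ v = 0 := Iff.rfl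

lemma le_dualCode_comm {C D : Submodule K (Fin n → K)} : C ≤ dualCode D ↔ D ≤ dualCode C :=
  ⟨fun h v hv u hu => by rw [dotProduct_comm]; exact h hu v hv,
    fun h v hv u hu => by rw [dotProduct_comm]; exact h hu v hv⟩

lemma finrank_add_finrank_dualCode (C : Submodule K (Fin n → K)) :
    finrank K C + finrank K (dualCode C) = n := by
  have h : dualCode C = C.dualAnnihilator.map (dotProductEquiv K (Fin n)).symm.toLinearMap := by
    ext u
    rw [Submodule.mem_map_equiv]
    simp [mem_dualCode, Submodule.mem_dualAnnihilator]
  rw [h, LinearEquiv.finrank_map_eq, Subspace.finrank_add_finrank_dualAnnihilator_eq]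
  simp

lemma dualCode_dualCode (C : Submodule K (Fin n → K)) : dualCode (dualCode C) = C := by
  refine (Submodule.eq_of_le_of_finrank_eq (le_dualCode_comm.1 le_rfl) ?_).symm
  have h₁ := finrank_add_finrank_dualCode C
  have h₂ := finrank_add_finrank_dualCode (dualCode C)
  omega

lemma dualCode_galImage (σ : K ≃ₐ[F] K) (C : Submodule K (Fin n → K)) :
    dualCode (galImage σ C) = galImage σ (dualCode C) := by
  ext u
  rw [mem_galImage, mem_dualCode, mem_dualCode]
  have key : ∀ v : Fin n → K, σ ((fun j => σ.symm (u j)) ⬝ᵥ v) = u ⬝ᵥ fun j => σ (v j) := by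
    intro v
    simp [dotProduct]
  constructor
  · intro h v hv
    have := h _ (map_mem_galImage hv)
    rwa [← key, map_eq_zero_iff _ σ.injective] at this
  · rintro h _ ⟨v, hv, rfl⟩
    rw [← key, h v hv, map_zero]

lemma dualCode_sumCode (σ : K ≃ₐ[F] K) (i : ℕ) (C : Submodule K (Fin n → K)) :
    dualCode (sumCode σ i C) = interCode σ i (dualCode C) := by
  refine eq_of_forall_le_iff fun A => ?_
  rw [le_dualCode_comm, sumCode, interCode]
  simp only [iSup_le_iff, le_iInf_iff, ← dualCode_galImage]
  exact forall₂_congr fun j _ => le_dualCode_comm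

lemma sumDim_add_interDim_dualCode (σ : K ≃ₐ[F] K) (i : ℕ) (C : Submodule K (Fin n → K)) :
    sumDim σ i C + interDim σ i (dualCode C) = n := by
  rw [sumDim, interDim, ← dualCode_sumCode, finrank_add_finrank_dualCode]

lemma interDim_add_sumDim_dualCode (σ : K ≃ₐ[F] K) (i : ℕ) (C : Submodule K (Fin n → K)) :
    interDim σ i C + sumDim σ i (dualCode C) = n := by
  have h := sumDim_add_interDim_dualCode σ i (dualCode C)
  rw [dualCode_dualCode] at h
  omega

end Dual

/-! ### Growth of the sum-dimensions -/

section Sequences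

variable {F K : Type*} [Field F] [Field K] [Algebra F K] {n : ℕ} {θ : K ≃ₐ[F] K}
  {C : Submodule K (Fin n → K)}

lemma sumCode_zero (θ : K ≃ₐ[F] K) (C : Submodule K (Fin n → K)) : sumCode θ 0 C = C := by
  simp [sumCode, galImage_one]

lemma sumDim_zero (θ : K ≃ₐ[F] K) (C : Submodule K (Fin n → K)) :
    sumDim θ 0 C = finrank K C := by rw [sumDim, sumCode_zero]

lemma sumCode_le_iff {i : ℕ} {D : Submodule K (Fin n → K)} :
    sumCode θ i C ≤ D ↔ ∀ j ≤ i, galImage (θ ^ j) C ≤ D := by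
  simp [sumCode]

lemma galImage_pow_le_sumCode {i j : ℕ} (h : j ≤ i) : galImage (θ ^ j) C ≤ sumCode θ i C :=
  sumCode_le_iff.1 le_rfl j h

lemma sumCode_mono (θ : K ≃ₐ[F] K) (C : Submodule K (Fin n → K)) :
    Monotone fun i => sumCode θ i C :=
  fun _ _ h => sumCode_le_iff.2 fun _ hj => galImage_pow_le_sumCode (hj.trans h)

lemma galImage_sumCode (i : ℕ) :
    galImage θ (sumCode θ i C) = ⨆ j ∈ Finset.range (i + 1), galImage (θ ^ (j + 1)) C := by
  rw [galImage_eq_galIso, sumCode]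
  simp only [OrderIso.map_iSup, galImage_pow_succ, galImage_eq_galIso θ]

lemma galImage_sumCode_le (i : ℕ) : galImage θ (sumCode θ i C) ≤ sumCode θ (i + 1) C := by
  rw [galImage_sumCode]
  simp only [iSup_le_iff, Finset.mem_range]
  exact fun j hj => galImage_pow_le_sumCode (by omega)

lemma sumCode_succ (i : ℕ) :
    sumCode θ (i + 1) C = sumCode θ i C ⊔ galImage θ (sumCode θ i C) := by
  refine le_antisymm (sumCode_le_iff.2 fun j hj => ?_)
    (sup_le (sumCode_mono θ C (Nat.le_succ i)) (galImage_sumCode_le i))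
  rcases Nat.lt_or_ge i j with h | h
  · obtain rfl : j = i + 1 := by omega
    rw [galImage_pow_succ]
    exact le_sup_of_le_right (galImage_mono θ (galImage_pow_le_sumCode le_rfl))
  · exact le_sup_of_le_left (galImage_pow_le_sumCode h)

lemma sumCode_sumCode_one (i : ℕ) : sumCode θ 1 (sumCode θ i C) = sumCode θ (i + 1) C := by
  rw [sumCode_succ 0, sumCode_zero, sumCode_succ]

lemma sumDim_mono (θ : K ≃ₐ[F] K) (C : Submodule K (Fin n → K)) :
    Monotone fun i => sumDim θ i C :=
  fun _ _ h => Submodule.finrank_mono (sumCode_mono θ C h)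

lemma sumDim_le (θ : K ≃ₐ[F] K) (i : ℕ) (C : Submodule K (Fin n → K)) : sumDim θ i C ≤ n := by
  have := sumDim_add_interDim_dualCode θ i C
  omega

/-- The increments of the sum-dimensions do not increase, because
`S_i ∩ θ(S_i)` contains `θ(S_{i-1})`. -/
lemma sumDim_concave (θ : K ≃ₐ[F] K) (i : ℕ) (C : Submodule K (Fin n → K)) :
    sumDim θ (i + 1 + 1) C + sumDim θ i C ≤ 2 * sumDim θ (i + 1) C := by
  have h := Submodule.finrank_sup_add_finrank_inf_eq (sumCode θ (i + 1) C)
    (galImage θ (sumCode θ (i + 1) C))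
  rw [← sumCode_succ, finrank_galImage] at h
  have h' : finrank K (galImage θ (sumCode θ i C)) ≤
      finrank K ↥(sumCode θ (i + 1) C ⊓ galImage θ (sumCode θ (i + 1) C)) :=
    Submodule.finrank_mono (le_inf (galImage_sumCode_le i)
      (galImage_mono θ (sumCode_mono θ C (Nat.le_succ i))))
  rw [finrank_galImage] at h'
  unfold sumDim
  omega

lemma interCode_one (θ : K ≃ₐ[F] K) (C : Submodule K (Fin n → K)) :
    interCode θ 1 C = C ⊓ galImage θ C := by
  refine le_antisymm (le_inf ?_ ?_) ?_
  · exact (iInf₂_le 0 (by simp)).trans (by rw [pow_zero, galImage_one])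
  · exact (iInf₂_le 1 (by simp)).trans (by rw [pow_one])
  · refine le_iInf₂ fun j hj => ?_
    obtain rfl | rfl : j = 0 ∨ j = 1 := by simp at hj; omega
    · rw [pow_zero, galImage_one]
      exact inf_le_left
    · rw [pow_one]
      exact inf_le_right

lemma sumDim_one_add_interDim_one (θ : K ≃ₐ[F] K) (C : Submodule K (Fin n → K)) :
    sumDim θ 1 C + interDim θ 1 C = 2 * finrank K C := by
  have h := Submodule.finrank_sup_add_finrank_inf_eq C (galImage θ C)
  have h₁ : sumCode θ 1 C = C ⊔ galImage θ C := by rw [sumCode_succ 0, sumCode_zero]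
  rw [finrank_galImage, ← h₁, ← interCode_one] at h
  unfold sumDim interDim
  omega

lemma galImage_sumCode_le_of_sumDim_eq {i : ℕ} (h : sumDim θ (i + 1) C ≤ sumDim θ i C) :
    galImage θ (sumCode θ i C) ≤ sumCode θ i C := by
  have := Submodule.eq_of_le_of_finrank_le (sumCode_mono θ C (Nat.le_succ i)) h
  exact (galImage_sumCode_le i).trans this.ge

/-- Once the chain `S_i(D)` stalls it is a `θ`-stable space, so it cannot stall inside a code
without rational vectors. -/
lemma sumDim_lt_succ_of_le_of_noRat
    (hfix : ∀ x : K, θ x = x → ∃ a : F, algebraMap F K a = x) {D : Submodule K (Fin n → K)}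
    (hD : D ≠ ⊥) (hC : NoRat F C) {i : ℕ} (h : sumCode θ i D ≤ C) :
    sumDim θ i D < sumDim θ (i + 1) D := by
  by_contra! hle
  obtain ⟨a, ha, haD⟩ := exists_ratVec_mem hfix
    (ne_bot_of_le_ne_bot hD ((sumCode_zero θ D).ge.trans (sumCode_mono θ D (Nat.zero_le i))))
    (galImage_sumCode_le_of_sumDim_eq hle)
  exact ha (hC a (h haD))

/-- If the dual code has no rational vectors, the chain `S_i(C)` grows until it fills the space. -/
lemma sumDim_lt_succ_of_noRat_dualCode
    (hfix : ∀ x : K, θ x = x → ∃ a : F, algebraMap F K a = x)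
    (hC : NoRat F (dualCode C)) {i : ℕ} (h : sumDim θ i C < n) :
    sumDim θ i C < sumDim θ (i + 1) C := by
  by_contra! hle
  have hne : dualCode (sumCode θ i C) ≠ ⊥ := by
    intro h0
    have := finrank_add_finrank_dualCode (sumCode θ i C)
    rw [h0, finrank_bot] at this
    unfold sumDim at h
    omega
  obtain ⟨a, ha, haD⟩ := exists_ratVec_mem (θ := θ) hfix hne (by
    rw [← dualCode_galImage, le_dualCode_comm, dualCode_dualCode]
    have hst := galImage_sumCode_le_of_sumDim_eq hle
    exact (Submodule.eq_of_le_of_finrank_eq hst (finrank_galImage _ _)).ge)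
  refine ha (hC a (le_dualCode_comm.1 ?_ haD))
  rw [dualCode_dualCode]
  exact (sumCode_zero θ C).ge.trans (sumCode_mono θ C (Nat.zero_le i))

lemma min_le_sumDim (hfix : ∀ x : K, θ x = x → ∃ a : F, algebraMap F K a = x)
    (hC : NoRat F (dualCode C)) (i : ℕ) : min n (finrank K C + i) ≤ sumDim θ i C := by
  induction i with
  | zero => simp [sumDim_zero]
  | succ i ih =>
    have hm : sumDim θ i C ≤ sumDim θ (i + 1) C := sumDim_mono θ C (Nat.le_succ i)
    rcases lt_or_ge (sumDim θ i C) n with h | h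
    · have := sumDim_lt_succ_of_noRat_dualCode hfix hC h
      omega
    · omega

lemma sumDim_le_of_sumDim_one (h₁ : sumDim θ 1 C ≤ finrank K C + 1) (i : ℕ) :
    sumDim θ (i + 1) C ≤ sumDim θ i C + 1 := by
  induction i with
  | zero => rwa [sumDim_zero]
  | succ i ih =>
    have := sumDim_concave θ i C
    omega

/-- A rational vector orthogonal to `C` is orthogonal to every `S_i(C)`. -/
lemma noRat_dualCode_of_sumDim_eq {i : ℕ} (h : sumDim θ i C = n) : NoRat F (dualCode C) := by
  intro a ha
  have hmem : ratVec K a ∈ dualCode (sumCode θ i C) := by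
    rw [dualCode_sumCode, interCode]
    simp only [Submodule.mem_iInf]
    exact fun j _ => ratVec_mem_galImage.2 ha
  have h0 : dualCode (sumCode θ i C) = ⊥ := by
    have := finrank_add_finrank_dualCode (sumCode θ i C)
    rw [← Submodule.finrank_eq_zero (R := K)]
    unfold sumDim at h
    omega
  rw [h0, Submodule.mem_bot] at hmem
  exact ratVec_eq_zero.1 hmem

end Sequences

/-! ### Minimum distance and the Singleton bound -/

section Distance

variable {F K : Type*} [Field F] [Field K] [Algebra F K] {n : ℕ} {C : Submodule K (Fin n → K)}

lemma minDist_mem (hC : C ≠ ⊥) : ∃ v ∈ C, v ≠ 0 ∧ qRank F v = minDist F C := by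
  have hne : {d : ℕ | ∃ u ∈ C, ∃ v ∈ C, u ≠ v ∧ d = rankDist F u v}.Nonempty := by
    obtain ⟨v, hv, hv0⟩ := C.exists_mem_ne_zero_of_ne_bot hC
    exact ⟨_, v, hv, 0, C.zero_mem, hv0, rfl⟩
  obtain ⟨u, hu, v, hv, huv, h⟩ := Nat.sInf_mem hne
  exact ⟨u - v, C.sub_mem hu hv, sub_ne_zero.2 huv, h.symm⟩

lemma minDist_le {v : Fin n → K} (hv : v ∈ C) (hv0 : v ≠ 0) : minDist F C ≤ qRank F v :=
  Nat.sInf_le ⟨v, hv, 0, C.zero_mem, hv0, by rw [rankDist, sub_zero]⟩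

lemma le_minDist_iff (hC : C ≠ ⊥) {d : ℕ} :
    d ≤ minDist F C ↔ ∀ v ∈ C, v ≠ 0 → d ≤ qRank F v := by
  refine ⟨fun h v hv hv0 => h.trans (minDist_le hv hv0), fun h => ?_⟩
  obtain ⟨v, hv, hv0, hd⟩ := minDist_mem (F := F) hC
  exact hd ▸ h v hv hv0

/-- The vectors of `q`-rank one are exactly the scalar multiples of rational vectors, so minimum
distance greater than one means that the code has no rational vectors. -/
lemma one_lt_minDist_iff (hC : C ≠ ⊥) : 1 < minDist F C ↔ NoRat F C := by
  rw [← Nat.succ_le_iff, le_minDist_iff hC]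
  constructor
  · intro h a ha
    by_contra ha0
    have h₂ := h _ ha (mt ratVec_eq_zero.1 ha0)
    have hle : Submodule.span F (Set.range (ratVec K a)) ≤ Submodule.span F {(1 : K)} := by
      rw [Submodule.span_le]
      rintro _ ⟨j, rfl⟩
      exact Submodule.mem_span_singleton.2 ⟨a j, by simp [ratVec, Algebra.smul_def]⟩
    have h₁ := Submodule.finrank_mono hle
    rw [finrank_span_singleton one_ne_zero] at h₁
    unfold qRank at h₂
    omega
  · intro h v hv hv0
    by_contra hlt
    obtain ⟨i, hi⟩ := Function.ne_iff.1 hv0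
    rw [Pi.zero_apply] at hi
    have : FiniteDimensional F (Submodule.span F (Set.range v)) :=
      FiniteDimensional.span_of_finite F (Set.finite_range v)
    have hspan : Submodule.span F {v i} = Submodule.span F (Set.range v) := by
      refine Submodule.eq_of_le_of_finrank_le (Submodule.span_mono (by simp)) ?_
      rw [finrank_span_singleton hi]
      unfold qRank at hlt
      omega
    have hmem : ∀ j, ∃ a : F, a • v i = v j := fun j =>
      Submodule.mem_span_singleton.1 (hspan ▸ Submodule.subset_span ⟨j, rfl⟩)
    choose a ha using hmem
    have hav : ratVec K a = (v i)⁻¹ • v := by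
      ext j
      rw [Pi.smul_apply, ← ha j, ratVec, Algebra.smul_def (a j), smul_eq_mul]
      field_simp
    have ha0 := h a (hav ▸ C.smul_mem _ hv)
    rw [ratVec_eq_zero.2 ha0, eq_comm, smul_eq_zero] at hav
    exact hav.elim (inv_ne_zero hi) hv0

lemma qRank_le_card_of_mem_span {v : Fin n → K} (T : Finset (Fin n))
    (h : ∀ j, v j ∈ Submodule.span F (v '' T)) : qRank F v ≤ T.card := by
  classical
  have hle : Submodule.span F (Set.range v) ≤ Submodule.span F ((T.image v : Finset K) : Set K) := by
    rw [Submodule.span_le, Finset.coe_image]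
    rintro _ ⟨j, rfl⟩
    exact h j
  calc qRank F v ≤ _ := Submodule.finrank_mono hle
    _ ≤ (T.image v).card := finrank_span_finset_le_card _
    _ ≤ T.card := Finset.card_image_le

lemma qRank_le_card_of_forall_notMem {v : Fin n → K} (T : Finset (Fin n))
    (h : ∀ j ∉ T, v j = 0) : qRank F v ≤ T.card := by
  refine qRank_le_card_of_mem_span T fun j => ?_
  by_cases hj : j ∈ T
  · exact Submodule.subset_span ⟨j, hj, rfl⟩
  · rw [h j hj]
    exact Submodule.zero_mem _

/-- Fewer than `dim C` coordinates can be made to vanish on a non-zero codeword. -/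
lemma exists_mem_forall_eq_zero (J : Finset (Fin n)) (hJ : J.card < finrank K C) :
    ∃ v ∈ C, v ≠ 0 ∧ ∀ j ∈ J, v j = 0 := by
  let f : C →ₗ[K] (J → K) := (LinearMap.funLeft K K (Subtype.val : J → Fin n)).comp C.subtype
  have hf : LinearMap.ker f ≠ ⊥ := LinearMap.ker_ne_bot_of_finrank_lt (by simpa using hJ)
  obtain ⟨v, hv, hv0⟩ := Submodule.exists_mem_ne_zero_of_ne_bot hf
  refine ⟨v, v.2, by simpa using hv0, fun j hj => ?_⟩
  exact congrFun (LinearMap.mem_ker.1 hv) ⟨j, hj⟩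

lemma singleton_bound (hC : C ≠ ⊥) : minDist F C + finrank K C ≤ n + 1 := by
  have hpos : 0 < finrank K C := Submodule.one_le_finrank_iff.2 hC
  have hn : finrank K C ≤ n := by simpa using Submodule.finrank_le C
  obtain ⟨J, -, hJ⟩ := Finset.exists_subset_card_eq (s := (Finset.univ : Finset (Fin n)))
    (n := finrank K C - 1) (by simp; omega)
  obtain ⟨v, hv, hv0, hvJ⟩ := exists_mem_forall_eq_zero (C := C) J (by omega)
  have h := (minDist_le (F := F) hv hv0).trans
    (qRank_le_card_of_forall_notMem Jᶜ fun j hj => hvJ j (by simpa using hj))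
  rw [Finset.card_compl, Fintype.card_fin] at h
  omega

/-- An MRD code satisfies no linear relation over `F`: with such a relation one coordinate would be
determined over `F` by the others, and a codeword vanishing on `dim C - 1` of these would violate
the minimum distance. -/
lemma IsMRD.noRat_dualCode (h : IsMRD F C) : NoRat F (dualCode C) := by
  intro a ha
  by_contra ha0
  obtain ⟨i, hi⟩ := Function.ne_iff.1 ha0
  rw [Pi.zero_apply] at hi
  obtain ⟨hC, hd⟩ := h
  have hpos : 0 < finrank K C := Submodule.one_le_finrank_iff.2 hC
  have hn : finrank K C ≤ n := by simpa using Submodule.finrank_le C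
  have hcard : (Finset.univ.erase i : Finset (Fin n)).card = n - 1 := by simp
  obtain ⟨J, hJi, hJ⟩ := Finset.exists_subset_card_eq (s := (Finset.univ.erase i : Finset (Fin n)))
    (n := finrank K C - 1) (by omega)
  obtain ⟨v, hv, hv0, hvJ⟩ := exists_mem_forall_eq_zero (C := C) J (by omega)
  have hT : (Finset.univ.erase i \ J).card = n - 1 - (finrank K C - 1) := by
    rw [Finset.card_sdiff_of_subset hJi, hcard, hJ]
  have hother : ∀ j, j ≠ i → v j ∈ Submodule.span F (v '' ↑(Finset.univ.erase i \ J)) := by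
    intro j hj
    by_cases hjJ : j ∈ J
    · rw [hvJ j hjJ]
      exact Submodule.zero_mem _
    · exact Submodule.subset_span ⟨j, by simp [hj, hjJ], rfl⟩
  have hle := qRank_le_card_of_mem_span (F := F) (v := v) (Finset.univ.erase i \ J) fun j => by
    rcases eq_or_ne j i with rfl | hj
    · have hrel := ha v hv
      rw [ratVec_dotProduct, ← Finset.add_sum_erase _ _ (Finset.mem_univ j)] at hrel
      have hvj : v j = -((a j)⁻¹ • ∑ l ∈ Finset.univ.erase j, a l • v l) := by
        rw [← neg_eq_of_add_eq_zero_right hrel, smul_neg, neg_neg, inv_smul_smul₀ hi]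
      rw [hvj]
      refine Submodule.neg_mem _ (Submodule.smul_mem _ _ (Submodule.sum_mem _ fun l hl => ?_))
      exact Submodule.smul_mem _ _ (hother l (Finset.ne_of_mem_erase hl))
    · exact hother j hj
  have := minDist_le (F := F) hv hv0
  omega

lemma IsMRD.noRat (h : IsMRD F C) (hn : finrank K C < n) : NoRat F C := by
  rw [← one_lt_minDist_iff h.1]
  have := h.2
  omega

end Distance

/-! ### Gabidulin codes -/

section Gabidulin

variable {F K : Type*} [Field F] [Field K] [Algebra F K] {n : ℕ} {θ : K ≃ₐ[F] K}
  {C : Submodule K (Fin n → K)}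

lemma gabCode_eq_span (k : ℕ) (θ : K ≃ₐ[F] K) (g : Fin n → K) :
    gabCode k θ g = Submodule.span K (Set.range fun (i : Fin k) j => (θ ^ (i : ℕ)) (g j)) := by
  rw [gabCode, gabSpace, Submodule.map_span, ← Set.range_comp]
  congr 2
  ext i j
  change (SkewMonoidAlgebra.single (θ ^ (i : ℕ)) (1 : K)).sum (fun σ a => a * σ (g j)) = _
  rw [SkewMonoidAlgebra.sum_single_index (zero_mul _), one_mul]

lemma galImage_span_singleton (σ : K ≃ₐ[F] K) (g : Fin n → K) :
    galImage σ (Submodule.span K {g}) = Submodule.span K {fun j => σ (g j)} := by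
  ext v
  rw [mem_galImage, Submodule.mem_span_singleton, Submodule.mem_span_singleton]
  constructor
  · rintro ⟨c, hc⟩
    refine ⟨σ c, ?_⟩
    ext j
    simpa using congrArg σ (congrFun hc j)
  · rintro ⟨c, rfl⟩
    exact ⟨σ.symm c, by ext j; simp⟩

/-- The Gabidulin code generated by `g` is a sum code of the line spanned by `g`. -/
lemma gabCode_succ_eq_sumCode (k : ℕ) (θ : K ≃ₐ[F] K) (g : Fin n → K) :
    gabCode (k + 1) θ g = sumCode θ k (Submodule.span K {g}) := by
  rw [gabCode_eq_span]
  refine le_antisymm (Submodule.span_le.2 ?_) (sumCode_le_iff.2 fun j hj => ?_)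
  · rintro _ ⟨i, rfl⟩
    exact galImage_pow_le_sumCode (Nat.lt_succ_iff.1 i.2)
      (map_mem_galImage (σ := θ ^ (i : ℕ)) (Submodule.mem_span_singleton_self g))
  · rw [galImage_span_singleton, Submodule.span_singleton_le_iff_mem]
    exact Submodule.subset_span ⟨⟨j, Nat.lt_succ_iff.2 hj⟩, rfl⟩

lemma noRat_dualCode_span_singleton {g : Fin n → K} (hg : LinearIndependent F g) :
    NoRat F (dualCode (Submodule.span K {g})) := fun a ha =>
  linearIndependent_iff_ratVec.1 hg a (ha g (Submodule.mem_span_singleton_self g))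

lemma finrank_gabCode (hfix : ∀ x : K, θ x = x → ∃ a : F, algebraMap F K a = x)
    {g : Fin n → K} (hg : LinearIndependent F g) {k : ℕ} (hk : k ≤ n) :
    finrank K (gabCode k θ g) = k := by
  refine le_antisymm ?_ ?_
  · rw [gabCode_eq_span]
    exact (finrank_range_le_card (R := K) _).trans (by simp)
  · cases k with
    | zero => simp
    | succ k =>
      have hg0 : g ≠ 0 := fun h => hg.ne_zero ⟨0, by omega⟩ (congrFun h _)
      have := min_le_sumDim hfix (noRat_dualCode_span_singleton hg) k
      rw [finrank_span_singleton hg0] at this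
      rw [gabCode_succ_eq_sumCode]
      unfold sumDim at this
      omega

/-- The rows of the Moore matrix of a vector with `F`-independent entries are independent. -/
lemma linearIndependent_moore (hfix : ∀ x : K, θ x = x → ∃ a : F, algebraMap F K a = x)
    {g : Fin n → K} (hg : LinearIndependent F g) {k : ℕ} (hk : k ≤ n) :
    LinearIndependent K fun (i : Fin k) (j : Fin n) => (θ ^ (i : ℕ)) (g j) := by
  rw [linearIndependent_iff_card_eq_finrank_span, Set.finrank, ← gabCode_eq_span,
    finrank_gabCode hfix hg hk, Fintype.card_fin]

/-- If a codeword `v = ∑ f_i θ^i(g)` satisfied `k` independent relations over `F`, the operator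
`∑ f_i θ^i` of degree less than `k` would kill `k` independent elements of `K`, and the Moore matrix
of these elements forces `f = 0`. -/
lemma isMRD_gabCode (hfix : ∀ x : K, θ x = x → ∃ a : F, algebraMap F K a = x)
    {g : Fin n → K} (hg : LinearIndependent F g) {k : ℕ} (hk : 0 < k) (hkn : k ≤ n) :
    IsMRD F (gabCode k θ g) := by
  have hdim := finrank_gabCode hfix hg hkn
  have hne : gabCode k θ g ≠ ⊥ := by
    intro h
    rw [h, finrank_bot] at hdim
    omega
  refine ⟨hne, le_antisymm (singleton_bound hne) ?_⟩
  suffices h : n + 1 - k ≤ minDist F (gabCode k θ g) by omega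
  rw [le_minDist_iff hne]
  intro v hv hv0
  by_contra! hlt
  apply hv0
  have hker := LinearMap.finrank_range_add_finrank_ker (Fintype.linearCombination F v)
  rw [Fintype.range_linearCombination, finrank_fin_fun] at hker
  have hk' : k ≤ finrank F (LinearMap.ker (Fintype.linearCombination F v)) := by
    unfold qRank at hlt
    omega
  let b := finBasis F (LinearMap.ker (Fintype.linearCombination F v))
  let a : Fin k → Fin n → F := fun l => (b (Fin.castLE hk' l)).1
  have ha : LinearIndependent F a :=
    (b.linearIndependent.map' _ (Submodule.ker_subtype _)).comp _ (Fin.castLE_injective hk')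
  have hav : ∀ l, ∑ j, a l j • v j = 0 := fun l => (b (Fin.castLE hk' l)).2
  let x : Fin k → K := fun l => ∑ j, a l j • g j
  have hx : LinearIndependent F x :=
    ha.map' (Fintype.linearCombination F g)
      (LinearMap.ker_eq_bot.2 (linearIndependent_iff_injective_fintypeLinearCombination.1 hg))
  rw [gabCode_eq_span, Submodule.mem_span_range_iff_exists_fun] at hv
  obtain ⟨f, rfl⟩ := hv
  have hf : ∀ i, f i = 0 := by
    refine Fintype.linearIndependent_iff.1 (linearIndependent_moore hfix hx le_rfl) f ?_
    ext l
    rw [Pi.zero_apply, ← hav l]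
    simp only [x, Finset.sum_apply, Pi.smul_apply, map_sum, map_smul, Finset.smul_sum]
    rw [Finset.sum_comm]
    exact Finset.sum_congr rfl fun j _ => Finset.sum_congr rfl fun i _ => smul_comm _ _ _
  simp [hf]

end Gabidulin

/-! ### The self-dual criterion -/

section Criterion

variable {F K : Type*} [Field F] [Field K] [Algebra F K] {n : ℕ} {θ : K ≃ₐ[F] K}
  {C : Submodule K (Fin n → K)}

/-- The self-dual criterion for Gabidulin codes: `dim (C + θ(C)) = dim C + 1`, and neither `C` nor
its dual contains a non-zero rational vector. -/
structure GabCriterion (θ : K ≃ₐ[F] K) (C : Submodule K (Fin n → K)) : Prop where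
  sumDim_one : sumDim θ 1 C = finrank K C + 1
  noRat : NoRat F C
  noRat_dual : NoRat F (dualCode C)

lemma GabCriterion.dual (h : GabCriterion θ C) : GabCriterion θ (dualCode C) := by
  refine ⟨?_, h.noRat_dual, by rw [dualCode_dualCode]; exact h.noRat⟩
  have h₁ := h.sumDim_one
  have h₂ := sumDim_one_add_interDim_one θ C
  have h₃ := interDim_add_sumDim_dualCode θ 1 C
  have h₄ := finrank_add_finrank_dualCode C
  omega

lemma gabCriterion_dualCode_iff : GabCriterion θ (dualCode C) ↔ GabCriterion θ C :=
  ⟨fun h => by simpa only [dualCode_dualCode] using h.dual, GabCriterion.dual⟩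

lemma GabCriterion.sumDim_eq (hfix : ∀ x : K, θ x = x → ∃ a : F, algebraMap F K a = x)
    (h : GabCriterion θ C) {i : ℕ} (hi : finrank K C + i ≤ n) :
    sumDim θ i C = finrank K C + i := by
  refine le_antisymm ?_ (by simpa [hi] using min_le_sumDim hfix h.noRat_dual i)
  clear hi
  induction i with
  | zero => simp [sumDim_zero]
  | succ i ih =>
    have := sumDim_le_of_sumDim_one h.sumDim_one.le i
    omega

lemma GabCriterion.interDim_eq (hfix : ∀ x : K, θ x = x → ∃ a : F, algebraMap F K a = x)
    (h : GabCriterion θ C) {i : ℕ} (hi : i ≤ finrank K C) :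
    interDim θ i C = finrank K C - i := by
  have h₁ := finrank_add_finrank_dualCode C
  have h₂ := interDim_add_sumDim_dualCode θ i C
  rw [h.dual.sumDim_eq hfix (by omega)] at h₂
  omega

/-- The space `C ∩ ⋯ ∩ θ^{k-1}(C)` is a line. If it is spanned by `θ^{k-1}(g)`, then
`g, …, θ^{k-1}(g)` lie in `C`, and they are independent since their span cannot stabilize inside
`C`. A linear relation over `F` between the entries of `g` would be a rational vector in `C^⊥`. -/
lemma GabCriterion.isGabidulin (hfix : ∀ x : K, θ x = x → ∃ a : F, algebraMap F K a = x)
    (h : GabCriterion θ C) (hC : 0 < finrank K C) : IsGabidulin (finrank K C) θ C := by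
  obtain ⟨k, hk⟩ : ∃ k, finrank K C = k + 1 := ⟨finrank K C - 1, by omega⟩
  have hkn : finrank K C ≤ n := by simpa using Submodule.finrank_le C
  have ht := h.interDim_eq hfix (i := k) (by omega)
  have hne : interCode θ k C ≠ ⊥ := by
    intro h0
    rw [interDim, h0, finrank_bot] at ht
    omega
  obtain ⟨w, hw, hw0⟩ := Submodule.exists_mem_ne_zero_of_ne_bot hne
  let g : Fin n → K := fun j => (θ ^ k).symm (w j)
  have hg0 : g ≠ 0 := by
    intro h0
    apply hw0
    ext j
    simpa [g] using congrFun h0 j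
  have hgC : ∀ i ≤ k, (fun j => (θ ^ i) (g j)) ∈ C := by
    intro i hi
    simp only [interCode, Submodule.mem_iInf] at hw
    have hmem := mem_galImage.1 (hw (k - i) (by simp))
    convert hmem using 2 with j
    rw [AlgEquiv.eq_symm_apply, ← AlgEquiv.mul_apply, ← pow_add, Nat.sub_add_cancel hi]
    exact AlgEquiv.apply_symm_apply _ _
  have hle : ∀ i ≤ k, sumCode θ i (Submodule.span K {g}) ≤ C := by
    refine fun i hi => sumCode_le_iff.2 fun j hj => ?_
    rw [galImage_span_singleton, Submodule.span_singleton_le_iff_mem]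
    exact hgC j (hj.trans hi)
  have hdim : ∀ i ≤ k, i + 1 ≤ sumDim θ i (Submodule.span K {g}) := by
    intro i
    induction i with
    | zero => intro _; rw [sumDim_zero, finrank_span_singleton hg0]
    | succ i ih =>
      intro hi
      have h₁ := ih (by omega)
      have h₂ := sumDim_lt_succ_of_le_of_noRat hfix
        (by simpa using hg0) h.noRat (hle i (by omega))
      omega
  have hCg : C = gabCode (finrank K C) θ g := by
    rw [hk, gabCode_succ_eq_sumCode]
    exact (Submodule.eq_of_le_of_finrank_le (hle k le_rfl) (hk ▸ hdim k le_rfl)).symm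
  refine ⟨hC, hkn, g, ?_, hCg⟩
  rw [qRank_eq_iff, linearIndependent_iff_ratVec]
  intro a ha
  have hmem : ratVec K a ∈ dualCode (Submodule.span K {g}) := by
    intro v hv
    obtain ⟨c, rfl⟩ := Submodule.mem_span_singleton.1 hv
    rw [dotProduct_smul, ha, smul_zero]
  refine h.noRat_dual a ?_
  rw [hCg, hk, gabCode_succ_eq_sumCode, dualCode_sumCode, interCode]
  simp only [Submodule.mem_iInf]
  exact fun j _ => ratVec_mem_galImage.2 hmem

lemma IsGabidulin.isMRD (hfix : ∀ x : K, θ x = x → ∃ a : F, algebraMap F K a = x)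
    {k : ℕ} (h : IsGabidulin k θ C) : IsMRD F C := by
  obtain ⟨h₁, h₂, g, hg, rfl⟩ := h
  exact isMRD_gabCode hfix (qRank_eq_iff.1 hg) h₁ h₂

lemma IsGabidulin.sumDim_one (hfix : ∀ x : K, θ x = x → ∃ a : F, algebraMap F K a = x)
    {k : ℕ} (h : IsGabidulin k θ C) (hkn : k < n) : sumDim θ 1 C = k + 1 := by
  obtain ⟨h₁, h₂, g, hg, rfl⟩ := h
  obtain ⟨k, rfl⟩ : ∃ j, k = j + 1 := ⟨k - 1, by omega⟩
  rw [gabCode_succ_eq_sumCode, sumDim, sumCode_sumCode_one, ← gabCode_succ_eq_sumCode]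
  exact finrank_gabCode hfix (qRank_eq_iff.1 hg) hkn

lemma isMRD_and_sumDim_one_iff (hfix : ∀ x : K, θ x = x → ∃ a : F, algebraMap F K a = x)
    (hC : 0 < finrank K C) (hn : finrank K C < n) :
    IsMRD F C ∧ sumDim θ 1 C = finrank K C + 1 ↔ GabCriterion θ C := by
  refine ⟨fun h => ⟨h.2, h.1.noRat hn, h.1.noRat_dualCode⟩, fun h => ?_⟩
  exact ⟨(h.isGabidulin hfix hC).isMRD hfix, h.sumDim_one⟩

lemma isGabidulin_iff (hfix : ∀ x : K, θ x = x → ∃ a : F, algebraMap F K a = x)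
    (hC : 0 < finrank K C) (hn : finrank K C < n) :
    IsGabidulin (finrank K C) θ C ↔ GabCriterion θ C := by
  refine ⟨fun h => (isMRD_and_sumDim_one_iff hfix hC hn).1 ⟨h.isMRD hfix, h.sumDim_one hfix hn⟩,
    fun h => h.isGabidulin hfix hC⟩

lemma sumDim_eq_and_noRat_iff (hfix : ∀ x : K, θ x = x → ∃ a : F, algebraMap F K a = x)
    (hn : finrank K C < n) :
    sumDim θ 1 C = finrank K C + 1 ∧ sumDim θ (n - finrank K C) C = n ∧ NoRat F C ↔
      GabCriterion θ C := by
  refine ⟨fun h => ⟨h.1, h.2.2, noRat_dualCode_of_sumDim_eq h.2.1⟩, fun h => ?_⟩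
  refine ⟨h.sumDim_one, ?_, h.noRat⟩
  rw [h.sumDim_eq hfix (by omega)]
  omega

lemma forall_sumDim_eq_and_noRat_iff
    (hfix : ∀ x : K, θ x = x → ∃ a : F, algebraMap F K a = x) (hn : finrank K C < n) :
    (∀ i ≤ n - finrank K C, sumDim θ i C = finrank K C + i) ∧ NoRat F C ↔ GabCriterion θ C := by
  refine ⟨fun h => (sumDim_eq_and_noRat_iff hfix hn).1 ⟨h.1 1 (by omega), ?_, h.2⟩, fun h => ?_⟩
  · rw [h.1 _ le_rfl]
    omega
  · exact ⟨fun i hi => h.sumDim_eq hfix (by omega), h.noRat⟩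

/-- By concavity of `i ↦ s_i`, two increments equal to one force all the increments in between to be
one. -/
lemma sumIncr_eq_one_and_noRat_iff (hfix : ∀ x : K, θ x = x → ∃ a : F, algebraMap F K a = x)
    (hn : finrank K C < n) :
    sumIncr θ 0 C = 1 ∧ sumIncr θ (n - finrank K C - 1) C = 1 ∧ NoRat F C ↔
      GabCriterion θ C := by
  unfold sumIncr
  constructor
  · rintro ⟨h₀, h₁, h₂⟩
    rw [sumDim_zero] at h₀
    -- walking down from the last increment, no earlier increment can be smaller than it
    have hdown : ∀ j ≤ n - finrank K C - 1,
        sumDim θ (n - finrank K C - 1 - j) C + 1 ≤ sumDim θ (n - finrank K C - 1 - j + 1) C := by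
      intro j
      induction j with
      | zero => intro _; simp only [Nat.sub_zero]; omega
      | succ j ih =>
        intro hj
        have h₃ := ih (by omega)
        have h₄ := sumDim_concave θ (n - finrank K C - 1 - (j + 1)) C
        rw [show n - finrank K C - 1 - j = n - finrank K C - 1 - (j + 1) + 1 by omega] at h₃
        omega
    have hup : ∀ i ≤ n - finrank K C, finrank K C + i ≤ sumDim θ i C := by
      intro i
      induction i with
      | zero => intro _; rw [sumDim_zero, add_zero]
      | succ i ih =>
        intro hi
        have h₃ := ih (by omega)
        have h₄ := hdown (n - finrank K C - 1 - i) (by omega)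
        rw [show n - finrank K C - 1 - (n - finrank K C - 1 - i) = i by omega] at h₄
        omega
    refine (sumDim_eq_and_noRat_iff hfix hn).1 ⟨by rw [zero_add] at h₀; omega, ?_, h₂⟩
    have h₃ := hup _ le_rfl
    have h₄ := sumDim_le θ (n - finrank K C) C
    omega
  · intro h
    refine ⟨?_, ?_, h.noRat⟩
    · rw [zero_add, h.sumDim_one, sumDim_zero]
      omega
    · rw [h.sumDim_eq hfix (by omega), h.sumDim_eq hfix (by omega)]
      omega

lemma forall_sumIncr_eq_one_and_noRat_iff
    (hfix : ∀ x : K, θ x = x → ∃ a : F, algebraMap F K a = x) (hn : finrank K C < n) :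
    (∀ i < n - finrank K C, sumIncr θ i C = 1) ∧ sumIncr θ (n - finrank K C) C = 0 ∧ NoRat F C ↔
      GabCriterion θ C := by
  refine ⟨fun h => (sumIncr_eq_one_and_noRat_iff hfix hn).1
    ⟨h.1 0 (by omega), h.1 _ (by omega), h.2.2⟩, fun h => ⟨fun i hi => ?_, ?_, h.noRat⟩⟩
  · unfold sumIncr
    rw [h.sumDim_eq hfix (by omega), h.sumDim_eq hfix (by omega)]
    omega
  · have h₁ := h.sumDim_eq hfix (i := n - finrank K C) (by omega)
    have h₂ := sumDim_le θ (n - finrank K C + 1) C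
    have h₃ : sumDim θ (n - finrank K C) C ≤ sumDim θ (n - finrank K C + 1) C :=
      sumDim_mono θ C (Nat.le_succ _)
    unfold sumIncr
    omega

lemma interDecr_eq_sumIncr_dualCode (θ : K ≃ₐ[F] K) (i : ℕ) (C : Submodule K (Fin n → K)) :
    interDecr θ i C = sumIncr θ i (dualCode C) := by
  have h₁ := interDim_add_sumDim_dualCode θ i C
  have h₂ := interDim_add_sumDim_dualCode θ (i + 1) C
  unfold interDecr sumIncr
  omega

end Criterion

/-! ### Systematic generator matrices -/

section Systematic

variable {F K : Type*} [Field F] [Field K] [Algebra F K] {k n : ℕ} (h : k ≤ n) {θ : K ≃ₐ[F] K}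

/-- The splitting of the coordinates into the `k` systematic ones and the `n - k` others. -/
def sysEquiv : Fin k ⊕ Fin (n - k) ≃ Fin n :=
  finSumFinEquiv.trans (finCongr (Nat.add_sub_of_le h))

lemma vecMul_systematicMatrix (X : Matrix (Fin k) (Fin (n - k)) K) (y : Fin k → K) :
    Matrix.vecMul y (systematicMatrix h X) =
      Sum.elim y (Matrix.vecMul y X) ∘ (sysEquiv h).symm := by
  have : systematicMatrix h X =
    (Matrix.fromCols (1 : Matrix (Fin k) (Fin k) K) X).submatrix (Equiv.refl _)
      (sysEquiv h).symm := rfl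
  rw [this, Matrix.submatrix_vecMul_equiv, Matrix.vecMul_fromCols]
  simp

/-- The code generated by `(I ∣ X)` consists of the vectors `(y, y X)`. -/
lemma mem_rowSpace_systematicMatrix {X : Matrix (Fin k) (Fin (n - k)) K} {v : Fin n → K} :
    v ∈ rowSpace (systematicMatrix h X) ↔
      (fun l => v (sysEquiv h (Sum.inr l))) =
        Matrix.vecMul (fun i => v (sysEquiv h (Sum.inl i))) X := by
  rw [rowSpace, ← range_vecMulLinear, LinearMap.mem_range]
  simp only [Matrix.vecMulLinear_apply, vecMul_systematicMatrix]
  constructor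
  · rintro ⟨y, rfl⟩
    simp
  · intro hv
    refine ⟨fun i => v (sysEquiv h (Sum.inl i)), ?_⟩
    ext j
    obtain ⟨j | j, rfl⟩ := (sysEquiv h).surjective j
    · simp
    · simpa using (congrFun hv j).symm

lemma mem_dualCode_rowSpace_systematicMatrix {X : Matrix (Fin k) (Fin (n - k)) K}
    {v : Fin n → K} :
    v ∈ dualCode (rowSpace (systematicMatrix h X)) ↔
      (fun i => v (sysEquiv h (Sum.inl i))) =
        -Matrix.mulVec X (fun l => v (sysEquiv h (Sum.inr l))) := by
  have key : ∀ y : Fin k → K, v ⬝ᵥ Matrix.vecMul y (systematicMatrix h X) =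
      y ⬝ᵥ ((fun i => v (sysEquiv h (Sum.inl i))) +
        Matrix.mulVec X (fun l => v (sysEquiv h (Sum.inr l)))) := by
    intro y
    rw [vecMul_systematicMatrix, dotProduct_comm, dotProduct_add, Matrix.dotProduct_mulVec,
      dotProduct, ← (sysEquiv h).sum_comp, Fintype.sum_sum_type]
    simp [dotProduct]
  rw [mem_dualCode, rowSpace, ← range_vecMulLinear]
  simp only [LinearMap.mem_range, Matrix.vecMulLinear_apply, forall_exists_index,
    forall_apply_eq_imp_iff, key]
  rw [eq_neg_iff_add_eq_zero]
  exact ⟨fun hy => dotProduct_eq_zero _ fun y => by rw [dotProduct_comm]; exact hy y,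
    fun h0 y => by rw [h0, dotProduct_zero]⟩

lemma galImage_rowSpace_systematicMatrix (θ : K ≃ₐ[F] K) (X : Matrix (Fin k) (Fin (n - k)) K) :
    galImage θ (rowSpace (systematicMatrix h X)) = rowSpace (systematicMatrix h (X.map θ)) := by
  ext v
  rw [mem_galImage, mem_rowSpace_systematicMatrix, mem_rowSpace_systematicMatrix, funext_iff,
    funext_iff]
  refine forall_congr' fun l => ?_
  rw [AlgEquiv.symm_apply_eq]
  simp [Matrix.vecMul, dotProduct]

lemma interDim_one_add_rank (θ : K ≃ₐ[F] K) (X : Matrix (Fin k) (Fin (n - k)) K) :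
    interDim θ 1 (rowSpace (systematicMatrix h X)) + (X.map θ - X).rank = k := by
  have hinj : Function.Injective (systematicMatrix h X).vecMulLinear := by
    intro y y' hy
    simp only [Matrix.vecMulLinear_apply, vecMul_systematicMatrix] at hy
    ext i
    simpa using congrFun hy (sysEquiv h (Sum.inl i))
  have hmap : interCode θ 1 (rowSpace (systematicMatrix h X)) =
      (LinearMap.ker (X.map θ - X).vecMulLinear).map (systematicMatrix h X).vecMulLinear := by
    rw [interCode_one, galImage_rowSpace_systematicMatrix]
    ext v
    rw [Submodule.mem_inf, Submodule.mem_map]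
    constructor
    · rintro ⟨h₁, h₂⟩
      obtain ⟨y, rfl⟩ : v ∈ LinearMap.range (systematicMatrix h X).vecMulLinear := by
        rw [range_vecMulLinear]
        exact h₁
      refine ⟨y, ?_, rfl⟩
      rw [mem_rowSpace_systematicMatrix] at h₂
      simp only [Matrix.vecMulLinear_apply, vecMul_systematicMatrix, Function.comp_apply,
        Equiv.symm_apply_apply, Sum.elim_inr, Sum.elim_inl] at h₂
      rw [LinearMap.mem_ker, Matrix.vecMulLinear_apply, Matrix.vecMul_sub, sub_eq_zero]
      exact h₂.symm
    · rintro ⟨y, hy, rfl⟩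
      rw [LinearMap.mem_ker, Matrix.vecMulLinear_apply, Matrix.vecMul_sub, sub_eq_zero] at hy
      rw [mem_rowSpace_systematicMatrix, mem_rowSpace_systematicMatrix]
      simp [vecMul_systematicMatrix, hy]
  rw [interDim, hmap, ← (Submodule.equivMapOfInjective _ hinj _).finrank_eq,
    Matrix.rank_eq_finrank_span_row, ← range_vecMulLinear, add_comm,
    LinearMap.finrank_range_add_finrank_ker, finrank_fin_fun]

lemma vecMul_map_ratVec (X : Matrix (Fin k) (Fin (n - k)) K) (y : Fin k → F) :
    Matrix.vecMul (ratVec K y) (X.map θ) = fun l => θ (Matrix.vecMul (ratVec K y) X l) := by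
  ext l
  simp [Matrix.vecMul, dotProduct, ratVec]

lemma mulVec_map_ratVec (X : Matrix (Fin k) (Fin (n - k)) K) (z : Fin (n - k) → F) :
    Matrix.mulVec (X.map θ) (ratVec K z) = fun i => θ (Matrix.mulVec X (ratVec K z) i) := by
  ext i
  simp [Matrix.mulVec, dotProduct, ratVec]

/-- For rational `y` the codeword `(y, y X)` is rational exactly when `y X` is fixed by `θ`. -/
lemma noRat_rowSpace_iff (hfix : ∀ x : K, θ x = x → ∃ a : F, algebraMap F K a = x)
    (X : Matrix (Fin k) (Fin (n - k)) K) :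
    NoRat F (rowSpace (systematicMatrix h X)) ↔
      ∀ y : Fin k → F, Matrix.vecMul (ratVec K y) (X.map θ - X) = 0 → y = 0 := by
  simp only [Matrix.vecMul_sub, sub_eq_zero, vecMul_map_ratVec, funext_iff]
  constructor
  · intro hC y hy
    choose z hz using fun l => hfix _ (hy l)
    have h0 := hC (Sum.elim y z ∘ (sysEquiv h).symm) (by
      rw [mem_rowSpace_systematicMatrix]
      have hyl : (fun i => ratVec K (Sum.elim y z ∘ (sysEquiv h).symm) (sysEquiv h (Sum.inl i))) =
          ratVec K y := by
        ext i
        simp [ratVec]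
      rw [hyl]
      ext l
      rw [← hz l]
      simp [ratVec])
    intro i
    simpa using congrFun h0 (sysEquiv h (Sum.inl i))
  · intro hX a ha
    rw [mem_rowSpace_systematicMatrix] at ha
    change (fun l => algebraMap F K (a (sysEquiv h (Sum.inr l)))) =
      Matrix.vecMul (ratVec K fun i => a (sysEquiv h (Sum.inl i))) X at ha
    have h0 := hX (fun i => a (sysEquiv h (Sum.inl i))) fun l => by simp [← ha]
    have hr : (ratVec K fun i => a (sysEquiv h (Sum.inl i))) = 0 :=
      ratVec_eq_zero.2 (funext h0)
    rw [hr, Matrix.zero_vecMul] at ha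
    ext j
    obtain ⟨j | j, rfl⟩ := (sysEquiv h).surjective j
    · exact h0 j
    · simpa using congrFun ha j

/-- For rational `z` the dual codeword `(-X z, z)` is rational exactly when `X z` is fixed
by `θ`. -/
lemma noRat_dualCode_rowSpace_iff (hfix : ∀ x : K, θ x = x → ∃ a : F, algebraMap F K a = x)
    (X : Matrix (Fin k) (Fin (n - k)) K) :
    NoRat F (dualCode (rowSpace (systematicMatrix h X))) ↔
      ∀ z : Fin (n - k) → F, Matrix.mulVec (X.map θ - X) (ratVec K z) = 0 → z = 0 := by
  simp only [Matrix.sub_mulVec, sub_eq_zero, mulVec_map_ratVec, funext_iff]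
  constructor
  · intro hC z hz
    choose y hy using fun i => hfix _ (hz i)
    have h0 := hC (Sum.elim (-y) z ∘ (sysEquiv h).symm) (by
      rw [mem_dualCode_rowSpace_systematicMatrix]
      have hzr : (fun l => ratVec K (Sum.elim (-y) z ∘ (sysEquiv h).symm)
          (sysEquiv h (Sum.inr l))) = ratVec K z := by
        ext l
        simp [ratVec]
      rw [hzr]
      ext i
      rw [Pi.neg_apply, ← hy i]
      simp [ratVec])
    intro l
    simpa using congrFun h0 (sysEquiv h (Sum.inr l))
  · intro hX a ha
    rw [mem_dualCode_rowSpace_systematicMatrix] at ha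
    change (fun i => algebraMap F K (a (sysEquiv h (Sum.inl i)))) =
      -Matrix.mulVec X (ratVec K fun l => a (sysEquiv h (Sum.inr l))) at ha
    have h0 := hX (fun l => a (sysEquiv h (Sum.inr l))) fun i => by
      simp [eq_neg_iff_add_eq_zero.1 ha |> eq_neg_of_add_eq_zero_right, ← map_neg]
    have hr : (ratVec K fun l => a (sysEquiv h (Sum.inr l))) = 0 :=
      ratVec_eq_zero.2 (funext h0)
    rw [hr, Matrix.mulVec_zero, neg_zero] at ha
    ext j
    obtain ⟨j | j, rfl⟩ := (sysEquiv h).surjective j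
    · simpa using congrFun ha j
    · exact h0 j

lemma exists_eq_vecMulVec_of_rank_eq_one {l m : ℕ} {M : Matrix (Fin l) (Fin m) K}
    (hM : M.rank = 1) : ∃ u w, M = Matrix.vecMulVec u w ∧ u ≠ 0 ∧ w ≠ 0 := by
  rw [Matrix.rank_eq_finrank_span_row] at hM
  obtain ⟨w, hw⟩ := ((Submodule.span K (Set.range M.row)).finrank_le_one_iff_isPrincipal.1 hM.le).1
  have hrow : ∀ i, ∃ c : K, c • w = M i := fun i =>
    Submodule.mem_span_singleton.1 (hw ▸ Submodule.subset_span ⟨i, rfl⟩)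
  choose u hu using hrow
  have hMuw : M = Matrix.vecMulVec u w := by
    ext i j
    rw [← hu i]
    rfl
  have hM0 : M ≠ 0 := by
    rintro rfl
    rw [← Matrix.rank_eq_finrank_span_row, Matrix.rank_zero] at hM
    exact zero_ne_one hM
  refine ⟨u, w, hMuw, ?_, ?_⟩
  · rintro rfl
    exact hM0 (by rw [hMuw, Matrix.zero_vecMulVec])
  · rintro rfl
    exact hM0 (by rw [hMuw]; ext; simp [Matrix.vecMulVec_apply])

lemma linearIndependent_smul_iff {m : ℕ} {c : K} (hc : c ≠ 0) {v : Fin m → K} :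
    LinearIndependent F (c • v) ↔ LinearIndependent F v := by
  simp only [linearIndependent_iff_ratVec, dotProduct_smul, smul_eq_zero, hc, false_or]

/-- If `θ(X) - X = u wᵀ`, the criterion says that the entries of `u` and those of `w` are
independent over `F`; the first row and the first column are multiples of `w` and `u`. -/
lemma gabCriterion_rowSpace_iff (hfix : ∀ x : K, θ x = x → ∃ a : F, algebraMap F K a = x)
    (hk : 0 < k) (hkn : k < n) (X : Matrix (Fin k) (Fin (n - k)) K)
    (hdim : finrank K (rowSpace (systematicMatrix h X)) = k) :
    ((X.map θ - X).rank = 1 ∧ qRank F ((X.map θ - X).row ⟨0, hk⟩) = n - k ∧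
        qRank F ((X.map θ - X).col ⟨0, Nat.sub_pos_of_lt hkn⟩) = k) ↔
      GabCriterion θ (rowSpace (systematicMatrix h X)) := by
  have hrank : (X.map θ - X).rank = 1 ↔ sumDim θ 1 (rowSpace (systematicMatrix h X)) =
      finrank K (rowSpace (systematicMatrix h X)) + 1 := by
    have h₁ := interDim_one_add_rank h θ X
    have h₂ := sumDim_one_add_interDim_one θ (rowSpace (systematicMatrix h X))
    omega
  suffices hM : (X.map θ - X).rank = 1 → ((qRank F ((X.map θ - X).row ⟨0, hk⟩) = n - k ∧
      qRank F ((X.map θ - X).col ⟨0, Nat.sub_pos_of_lt hkn⟩) = k) ↔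
        NoRat F (rowSpace (systematicMatrix h X)) ∧
          NoRat F (dualCode (rowSpace (systematicMatrix h X)))) from
    ⟨fun h₁ => ⟨hrank.1 h₁.1, ((hM h₁.1).1 h₁.2).1, ((hM h₁.1).1 h₁.2).2⟩,
      fun h₁ => ⟨hrank.2 h₁.1, (hM (hrank.2 h₁.1)).2 ⟨h₁.2, h₁.3⟩⟩⟩
  intro hr
  rw [noRat_rowSpace_iff h hfix, noRat_dualCode_rowSpace_iff h hfix]
  obtain ⟨u, w, hM, hu, hw⟩ := exists_eq_vecMulVec_of_rank_eq_one hr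
  rw [hM, qRank_eq_iff, qRank_eq_iff]
  have hu' : (∀ y : Fin k → F, Matrix.vecMul (ratVec K y) (Matrix.vecMulVec u w) = 0 → y = 0) ↔
      LinearIndependent F u := by
    simp only [Matrix.vecMul_vecMulVec, smul_eq_zero, hw, or_false, linearIndependent_iff_ratVec]
  have hw' : (∀ z : Fin (n - k) → F, Matrix.mulVec (Matrix.vecMulVec u w) (ratVec K z) = 0 →
      z = 0) ↔ LinearIndependent F w := by
    simp only [Matrix.vecMulVec_mulVec, smul_eq_zero, hu, or_false,
      MulOpposite.op_eq_zero_iff, linearIndependent_iff_ratVec, dotProduct_comm w]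
  have hrow : (Matrix.vecMulVec u w).row ⟨0, hk⟩ = u ⟨0, hk⟩ • w := rfl
  have hcol : (Matrix.vecMulVec u w).col ⟨0, Nat.sub_pos_of_lt hkn⟩ =
      w ⟨0, Nat.sub_pos_of_lt hkn⟩ • u := by
    ext i
    exact mul_comm _ _
  rw [hu', hw', hrow, hcol]
  constructor
  · rintro ⟨h₁, h₂⟩
    have hu0 : u ⟨0, hk⟩ ≠ 0 := fun h0 =>
      h₁.ne_zero ⟨0, Nat.sub_pos_of_lt hkn⟩ (by simp [h0])
    have hw0 : w ⟨0, Nat.sub_pos_of_lt hkn⟩ ≠ 0 := fun h0 => h₂.ne_zero ⟨0, hk⟩ (by simp [h0])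
    exact ⟨(linearIndependent_smul_iff hw0).1 h₂, (linearIndependent_smul_iff hu0).1 h₁⟩
  · rintro ⟨h₁, h₂⟩
    exact ⟨(linearIndependent_smul_iff (h₁.ne_zero _)).2 h₂,
      (linearIndependent_smul_iff (h₂.ne_zero _)).2 h₁⟩

/-- An MRD code has a systematic generator matrix: a codeword vanishing on the first `k` coordinates
has rank at most `n - k`, so it is zero and any `k` coordinates form an information set. -/
lemma IsMRD.exists_eq_rowSpace {C : Submodule K (Fin n → K)} (hC : IsMRD F C)
    (hdim : finrank K C = k) :
    ∃ X : Matrix (Fin k) (Fin (n - k)) K, C = rowSpace (systematicMatrix h X) := by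
  let f : C →ₗ[K] (Fin k → K) :=
    (LinearMap.funLeft K K fun i => sysEquiv h (Sum.inl i)).comp C.subtype
  have hzero : ∀ v ∈ C, (∀ i, v (sysEquiv h (Sum.inl i)) = 0) → v = 0 := by
    intro v hv hv₀
    by_contra hne
    have hle := qRank_le_card_of_forall_notMem (F := F) (v := v)
      (Finset.univ.map ((Function.Embedding.inr).trans (sysEquiv h).toEmbedding)) fun j hj => by
        obtain ⟨j | j, rfl⟩ := (sysEquiv h).surjective j
        · exact hv₀ j
        · exact absurd hj (by simp)
    rw [Finset.card_map, Finset.card_univ, Fintype.card_fin] at hle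
    have h₁ := minDist_le (F := F) hv hne
    have h₂ := hC.2
    omega
  have hinj : Function.Injective f := by
    rw [← LinearMap.ker_eq_bot, LinearMap.ker_eq_bot']
    exact fun v hv => Subtype.ext (hzero v v.2 fun i => congrFun hv i)
  have hsurj : Function.Surjective f :=
    (LinearMap.injective_iff_surjective_of_finrank_eq_finrank (by simp [hdim])).1 hinj
  choose b hb using fun i : Fin k => hsurj (Pi.single i 1)
  have hbi : ∀ i i', (b i).1 (sysEquiv h (Sum.inl i')) = (Pi.single i 1 : Fin k → K) i' :=
    fun i i' => congrFun (hb i) i'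
  let X : Matrix (Fin k) (Fin (n - k)) K := Matrix.of fun i l => (b i).1 (sysEquiv h (Sum.inr l))
  have hX : ∀ i, (systematicMatrix h X).row i = (b i).1 := by
    intro i
    rw [← Matrix.single_one_vecMul, vecMul_systematicMatrix]
    ext j
    obtain ⟨j | j, rfl⟩ := (sysEquiv h).surjective j
    · simp [hbi]
    · simp [X]
  have hle : rowSpace (systematicMatrix h X) ≤ C := by
    rw [rowSpace, Submodule.span_le]
    rintro _ ⟨i, rfl⟩
    rw [hX]
    exact (b i).2
  refine ⟨X, le_antisymm (fun v hv => ?_) hle⟩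
  -- `v` agrees on the first `k` coordinates with the combination of the rows that it prescribes
  have hw : Matrix.vecMul (fun i => v (sysEquiv h (Sum.inl i))) (systematicMatrix h X) ∈
      rowSpace (systematicMatrix h X) := by
    rw [rowSpace, ← range_vecMulLinear]
    exact ⟨_, rfl⟩
  have h0 := hzero _ (C.sub_mem hv (hle hw)) fun i => by simp [vecMul_systematicMatrix]
  rw [sub_eq_zero.1 h0]
  exact hw

end Systematic

/-! ### The equivalences -/

lemma exists_algebraMap_eq_of_zpowers_eq_top {F K : Type*} [Field F] [Finite F] [Field K]
    [Algebra F K] [FiniteDimensional F K] {θ : K ≃ₐ[F] K} (hθ : Subgroup.zpowers θ = ⊤) (x : K)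
    (hx : θ x = x) : ∃ a : F, algebraMap F K a = x := by
  have : Finite K := Module.finite_of_finite F
  have hmem : x ∈ (⊥ : IntermediateField F K) := by
    refine (IsGalois.mem_bot_iff_fixed x).2 fun σ => ?_
    have hσ : Subgroup.zpowers θ ≤ MulAction.stabilizer (K ≃ₐ[F] K) x :=
      Subgroup.zpowers_le.2 hx
    rw [hθ] at hσ
    exact hσ (Subgroup.mem_top σ)
  exact IntermediateField.mem_bot.1 hmem

end RankMetric

open RankMetric

theorem mainTheorem2 {F K : Type*} [Field F] [Finite F] [Field K] [Algebra F K]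
    [FiniteDimensional F K] (θ : K ≃ₐ[F] K) (hθ : Subgroup.zpowers θ = ⊤)
    (n k : ℕ) (hk : 0 < k) (hkn : k < n) (hnm : n ≤ Module.finrank F K)
    (C : Submodule K (Fin n → K)) (hC : Module.finrank K C = k) :
    List.TFAE [
      RankMetric.IsGabidulin k θ C,
      RankMetric.IsGabidulin (n - k) θ (RankMetric.dualCode C),
      RankMetric.IsMRD F C ∧ RankMetric.sumDim θ 1 C = k + 1,
      RankMetric.IsMRD F C ∧ RankMetric.interDim θ 1 C = k - 1,
      (∀ i ≤ n - k, RankMetric.sumDim θ i C = k + i) ∧ 1 < RankMetric.minDist F C,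
      (∀ i ≤ k, RankMetric.interDim θ i C = k - i) ∧
        1 < RankMetric.minDist F (RankMetric.dualCode C),
      RankMetric.sumDim θ 1 C = k + 1 ∧ RankMetric.sumDim θ (n - k) C = n ∧
        1 < RankMetric.minDist F C,
      RankMetric.interDim θ 1 C = k - 1 ∧ RankMetric.interDim θ k C = 0 ∧
        1 < RankMetric.minDist F (RankMetric.dualCode C),
      (∀ i < n - k, RankMetric.sumIncr θ i C = 1) ∧ RankMetric.sumIncr θ (n - k) C = 0 ∧
        1 < RankMetric.minDist F C,
      (∀ i < k, RankMetric.interDecr θ i C = 1) ∧ RankMetric.interDecr θ k C = 0 ∧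
        1 < RankMetric.minDist F (RankMetric.dualCode C),
      RankMetric.sumIncr θ 0 C = 1 ∧ RankMetric.sumIncr θ (n - k - 1) C = 1 ∧
        1 < RankMetric.minDist F C,
      RankMetric.interDecr θ 0 C = 1 ∧ RankMetric.interDecr θ (k - 1) C = 1 ∧
        1 < RankMetric.minDist F (RankMetric.dualCode C),
      ∃ X : Matrix (Fin k) (Fin (n - k)) K,
        C = RankMetric.rowSpace (RankMetric.systematicMatrix hkn.le X) ∧
        (X.map θ - X).rank = 1 ∧
        RankMetric.qRank F ((X.map θ - X).row ⟨0, hk⟩) = n - k ∧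
        RankMetric.qRank F ((X.map θ - X).col ⟨0, Nat.sub_pos_of_lt hkn⟩) = k] := by
  have hfix := exists_algebraMap_eq_of_zpowers_eq_top hθ
  have hdim := finrank_add_finrank_dualCode C
  have hC' : finrank K (dualCode C) = n - k := by omega
  have hnk : n - (n - k) = k := by omega
  have hne : C ≠ ⊥ := Submodule.one_le_finrank_iff.1 (by omega)
  have hne' : dualCode C ≠ ⊥ := Submodule.one_le_finrank_iff.1 (by omega)
  have hi := fun i => interDim_add_sumDim_dualCode θ i C
  have hst := sumDim_one_add_interDim_one θ C
  rw [one_lt_minDist_iff hne, one_lt_minDist_iff hne']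
  have hdual := gabCriterion_dualCode_iff (θ := θ) (C := C)
  have hMRD : IsMRD F C ∧ sumDim θ 1 C = k + 1 ↔ GabCriterion θ C := by
    simpa only [hC] using isMRD_and_sumDim_one_iff (θ := θ) (C := C) hfix (by omega) (by omega)
  refine List.tfae_of_forall (GabCriterion θ C) _ ?_
  simp only [List.forall_mem_cons, List.not_mem_nil, false_imp_iff, implies_true, and_true]
  refine ⟨?_, ?_, hMRD, ?_, ?_, ?_, ?_, ?_, ?_, ?_, ?_, ?_, ?_⟩
  · simpa only [hC] using isGabidulin_iff (θ := θ) (C := C) hfix (by omega) (by omega)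
  · rw [← hdual]
    simpa only [hC'] using isGabidulin_iff (θ := θ) (C := dualCode C) hfix (by omega) (by omega)
  · rw [← hMRD]
    exact and_congr_right fun _ => by omega
  · simpa only [hC] using forall_sumDim_eq_and_noRat_iff (θ := θ) (C := C) hfix (by omega)
  · rw [← hdual, ← forall_sumDim_eq_and_noRat_iff hfix (by omega), hC', hnk]
    refine and_congr_left fun _ => forall₂_congr fun i hik => ?_
    have := hi i
    omega
  · simpa only [hC] using sumDim_eq_and_noRat_iff (θ := θ) (C := C) hfix (by omega)
  · rw [← hdual, ← sumDim_eq_and_noRat_iff hfix (by omega), hC', hnk]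
    have h₁ := hi 1
    have h₂ := hi k
    exact and_congr (by omega) (and_congr_left fun _ => by omega)
  · simpa only [hC] using forall_sumIncr_eq_one_and_noRat_iff (θ := θ) (C := C) hfix (by omega)
  · rw [← hdual, ← forall_sumIncr_eq_one_and_noRat_iff hfix (by omega), hC', hnk]
    simp only [interDecr_eq_sumIncr_dualCode]
  · simpa only [hC] using sumIncr_eq_one_and_noRat_iff (θ := θ) (C := C) hfix (by omega)
  · rw [← hdual, ← sumIncr_eq_one_and_noRat_iff hfix (by omega), hC', hnk]
    simp only [interDecr_eq_sumIncr_dualCode]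
  · constructor
    · rintro ⟨X, rfl, hX⟩
      exact (gabCriterion_rowSpace_iff hkn.le hfix hk hkn X hC).1 hX
    · intro h
      obtain ⟨X, rfl⟩ := (hMRD.2 h).1.exists_eq_rowSpace hkn.le hC
      exact ⟨X, rfl, (gabCriterion_rowSpace_iff hkn.le hfix hk hkn X hC).2 h⟩
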